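/- Let $(X,d)$ be a metric space, and write $(x|y)_w=\frac12\big(d(x,w)+d(y,w)-d(x,y)\big)$ for $x,y,w\in X$. The space is *geodesic* if any two points are joined by an isometrically embedded segment, *proper* if its closed balls are compact, and *$\delta$-hyperbolic* if $(x|y)_w\ge\min\{(x|z)_w,(z|y)_w\}-\delta$ for all $x,y,z,w\in X$. A sequence $(x_i)$ in $X$ is a *Gromov sequence* if $(x_i|x_j)_w\to\infty$ as $i,j\to\infty$; two Gromov sequences are equivalent if $(x_i|y_i)_w\to\infty$ as $i\to\infty$, and the boundary at infinity $\partial_\infty X$ is the set of equivalence classes (none of this depends on $w\in X$). For $\xi\in\partial_\infty X$ and $K\ge 0$, the space $X$ is *$K$-roughly starlike* with respect to $\xi$ if for every $x\in X$ there are $\eta\in\partial_\infty X$ and a geodesic line from $\xi$ to $\eta$ whose distance to $x$ is at most $K$. For $w\in X$ and $\varepsilon>0$ with $\varepsilon<1$ and $5\delta\varepsilon<1$, the *visual metric* on $\partial_\infty X$ with base point $w$ and parameter $\varepsilon$ is $$d_{w,\varepsilon}(\xi,\zeta)=\inf\Big\{\sum_{i=1}^n e^{-\varepsilon(\xi_{i-1}|\xi_i)_w}: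 n\ge1,\ \xi=\xi_0,\xi_1,\dots,\xi_n=\zeta\in\partial_\infty X\Big\},$$ where $(\xi|\zeta)_w=\inf\{\liminf_{i\to\infty}(x_i|y_i)_w:(x_i)\in\xi,\ (y_i)\in\zeta\}\in[0,\infty]$ for $\xi,\zeta\in\partial_\infty X$ and $e^{-\infty}=0$. A metric space $Z$ is *$C$-uniformly perfect* if $C\ge1$ and for all $z\in Z$ and $r>0$ the set $B(z,r)\setminus B(z,r/C)$ is non-empty whenever $Z\setminus B(z,r)$ is non-empty ($B$ denotes open balls). A map $f:X\to X$ (not necessarily continuous) is a *rough $(\lambda,\mu)$-quasi-isometry* if $\lambda^{-1}d(x,y)-\mu\le d(f(x),f(y))\le\lambda d(x,y)+\mu$ for all $x,y\in X$ and every point of $X$ has distance at most $\mu$ from $f(X)$. It *extends as the identity* on $\partial_\infty X$ if for every $\xi\in\partial_\infty X$ and every Gromov sequence $(x_i)\in\xi$ the sequence $(f(x_i))$ is again a Gromov sequence in the class $\xi$. **Theorem 1.2.** Let $\delta,K,C,\mu\ge0$, $\lambda\ge1$, and let $0<\varepsilon<1$ with $5\delta\varepsilon<1$. There is a number $\Lambda=\Lambda(\delta,K,C,\lambda,\mu,\varepsilon)$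 such that the following holds. Let $(X,d)$ be a proper, geodesic, $\delta$-hyperbolic space that is $K$-roughly starlike with respect to some point $\xi\in\partial_\infty X$. Suppose that $\partial_\infty X$ contains at least two points and is $C$-uniformly perfect with respect to a visual metric $d_{w,\varepsilon}$ with parameter $\varepsilon$ and some base point $w\in X$. Then every rough $(\lambda,\mu)$-quasi-isometry $f:X\to X$ that extends as the identity on $\partial_\infty X$ satisfies $$d(x,f(x))\le\Lambda\qquad\text{for all }x\in X.$$ -/

import Mathlib

noncomputable section

namespace GromovHyp

open Filter

/-! ### Geodesic and Gromov hyperbolic spaces -/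

/-- A metric space is geodesic if any two points are joined by an isometrically embedded
segment. -/
def IsGeodesicSpace (X : Type*) [MetricSpace X] : Prop :=
  ∀ x y : X, ∃ γ : ℝ → X, γ 0 = x ∧ γ (dist x y) = y ∧
    ∀ s ∈ Set.Icc (0 : ℝ) (dist x y), ∀ t ∈ Set.Icc (0 : ℝ) (dist x y),
      dist (γ s) (γ t) = |s - t|

/-- The Gromov product `(x|y)_w`. -/
def gromovProd {X : Type*} [MetricSpace X] (w x y : X) : ℝ :=
  (dist x w + dist y w - dist x y) / 2

/-- `X` is `δ`-hyperbolic: `(x|y)_w ≥ min ((x|z)_w) ((z|y)_w) - δ` for all points. -/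
def IsHyperbolic (X : Type*) [MetricSpace X] (δ : ℝ) : Prop :=
  ∀ x y z w : X, min (gromovProd w x z) (gromovProd w z y) - δ ≤ gromovProd w x y

/-! ### The boundary at infinity -/

/-- Gromov sequences: `(s i | s j)_w → ∞` as `i, j → ∞`. A change of the base point changes
Gromov products by a bounded amount only, so it does not matter which `w` is used. -/
def IsGromovSeq {X : Type*} [MetricSpace X] (s : ℕ → X) : Prop :=
  ∀ w : X, Tendsto (fun p : ℕ × ℕ => gromovProd w (s p.1) (s p.2)) atTop atTop

/-- The type of Gromov sequences of `X`. -/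
abbrev GromovSeq (X : Type*) [MetricSpace X] : Type _ := {s : ℕ → X // IsGromovSeq s}

/-- Two Gromov sequences are equivalent if `(s i | t i)_w → ∞`. -/
def SeqEquiv {X : Type*} [MetricSpace X] (s t : GromovSeq X) : Prop :=
  ∀ w : X, Tendsto (fun i : ℕ => gromovProd w (s.1 i) (t.1 i)) atTop atTop

/-- The boundary at infinity: Gromov sequences up to equivalence. In a hyperbolic space
`SeqEquiv` is an equivalence relation, so that points of the quotient are its classes; see
`mk_eq_mk_iff`. -/
def Boundary (X : Type*) [MetricSpace X] : Type _ := Quot (SeqEquiv (X := X))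

/-- `Represents s ξ`: the sequence `s` is a Gromov sequence and belongs to the class `ξ`. -/
def Represents {X : Type*} [MetricSpace X] (s : ℕ → X) (ξ : Boundary X) : Prop :=
  ∃ h : IsGromovSeq s, (Quot.mk SeqEquiv ⟨s, h⟩ : Boundary X) = ξ

lemma gromovProd_comm {X : Type*} [MetricSpace X] (w x y : X) :
    gromovProd w x y = gromovProd w y x := by
  simp only [gromovProd, dist_comm x y]
  ring

lemma seqEquiv_equivalence {X : Type*} [MetricSpace X] {δ : ℝ} (hX : IsHyperbolic X δ) :
    Equivalence (SeqEquiv (X := X)) where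
  refl s w := (s.2 w).comp (tendsto_id.prodMk tendsto_id |>.mono_right (by
    rw [prod_atTop_atTop_eq]))
  symm {s t} h w := by simpa only [gromovProd_comm] using h w
  trans {s t u} h₁ h₂ w := by
    have h : Tendsto (fun i : ℕ => min (gromovProd w (s.1 i) (t.1 i))
        (gromovProd w (t.1 i) (u.1 i)) - δ) atTop atTop := by
      refine tendsto_atTop_add_const_right _ _ (tendsto_atTop.2 fun b => ?_)
      filter_upwards [(h₁ w).eventually_ge_atTop b, (h₂ w).eventually_ge_atTop b] with i h h'
      exact le_min h h'
    exact tendsto_atTop_mono (fun i => hX _ _ _ _) h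

/-- In a hyperbolic space, two Gromov sequences define the same boundary point exactly if they
are equivalent. -/
lemma mk_eq_mk_iff {X : Type*} [MetricSpace X] {δ : ℝ} (hX : IsHyperbolic X δ)
    (s t : GromovSeq X) :
    (Quot.mk SeqEquiv s : Boundary X) = Quot.mk SeqEquiv t ↔ SeqEquiv s t :=
  ⟨fun h => (seqEquiv_equivalence hX).eqvGen_iff.1 (Quot.eqvGen_exact h), Quot.sound⟩

/-! ### Visual metrics -/

/-- The Gromov product of two boundary points, an extended real: the infimum of
`liminf (x_i | y_i)_w` over all sequences `x` in the class `ξ` and `y` in the class `ζ`. -/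
def boundaryProd {X : Type*} [MetricSpace X] (w : X) (ξ ζ : Boundary X) : EReal :=
  sInf {a : EReal | ∃ x y : ℕ → X, Represents x ξ ∧ Represents y ζ ∧
    a = liminf (fun i : ℕ => ((gromovProd w (x i) (y i) : ℝ) : EReal)) atTop}

/-- `ρ_{w,ε}(ξ,ζ) = exp (-ε (ξ|ζ)_w)`, with `exp (-∞) = 0`. -/
def visualRho {X : Type*} [MetricSpace X] (w : X) (ε : ℝ) (ξ ζ : Boundary X) : ℝ :=
  (EReal.exp (-((ε : EReal) * boundaryProd w ξ ζ))).toReal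

/-- The visual (Bourdon) metric `d_{w,ε}` on the boundary: the infimum of
`∑ ρ_{w,ε}(ξ_i, ξ_{i+1})` over all finite chains from `ξ` to `ζ`. -/
def visualDist {X : Type*} [MetricSpace X] (w : X) (ε : ℝ) (ξ ζ : Boundary X) : ℝ :=
  sInf {r : ℝ | ∃ (n : ℕ) (c : ℕ → Boundary X), 1 ≤ n ∧ c 0 = ξ ∧ c n = ζ ∧
    r = ∑ i ∈ Finset.range n, visualRho w ε (c i) (c (i + 1))}

/-- Uniform perfectness with constant `C ≥ 1` of a set `Z` with a distance function `d`:
`B(z,r) \ B(z,r/C)` is non-empty whenever `Z \ B(z,r)` is non-empty (open balls). -/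
def IsUniformlyPerfect {Z : Type*} (d : Z → Z → ℝ) (C : ℝ) : Prop :=
  1 ≤ C ∧ ∀ (z : Z) (r : ℝ), 0 < r → (∃ y, r ≤ d z y) → ∃ y, r / C ≤ d z y ∧ d z y < r

/-! ### Rough starlikeness -/

/-- `γ` is a geodesic line from the boundary point `ξ` to the boundary point `η`. -/
def IsGeodesicLine {X : Type*} [MetricSpace X] (γ : ℝ → X) (ξ η : Boundary X) : Prop :=
  (∀ s t : ℝ, dist (γ s) (γ t) = |s - t|) ∧
    Represents (fun n : ℕ => γ (-(n : ℝ))) ξ ∧ Represents (fun n : ℕ => γ (n : ℝ)) η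

/-- `X` is `K`-roughly starlike with respect to the boundary point `ξ`: each point is at distance
at most `K` from some geodesic line that has `ξ` as one of its endpoints. -/
def IsRoughlyStarlike {X : Type*} [MetricSpace X] (ξ : Boundary X) (K : ℝ) : Prop :=
  ∀ x : X, ∃ (η : Boundary X) (γ : ℝ → X), IsGeodesicLine γ ξ η ∧
    Metric.infDist x (Set.range γ) ≤ K

/-! ### Rough quasi-isometries and their boundary values -/

/-- `f` is a rough `(L, M)`-quasi-isometry (not necessarily continuous). -/
def IsRoughQuasiIsometry {X Y : Type*} [MetricSpace X] [MetricSpace Y] (f : X → Y)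
    (L M : ℝ) : Prop :=
  (∀ x y : X, L⁻¹ * dist x y - M ≤ dist (f x) (f y) ∧ dist (f x) (f y) ≤ L * dist x y + M) ∧
    ∀ y : Y, Metric.infDist y (Set.range f) ≤ M

/-- `g` is the extension of `f` to the boundary at infinity: `f` maps each Gromov sequence in the
class `ξ` to a Gromov sequence in the class `g ξ`. -/
def IsBoundaryExtension {X Y : Type*} [MetricSpace X] [MetricSpace Y] (f : X → Y)
    (g : Boundary X → Boundary Y) : Prop :=
  ∀ (s : ℕ → X) (ξ : Boundary X), Represents s ξ → Represents (fun n => f (s n)) (g ξ)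

/-- The class of rough `(L, M)`-quasi-isometries of `X` whose extension to the boundary at
infinity is the identity. -/
def teichmullerClass (X : Type*) [MetricSpace X] (L M : ℝ) : Set (X → X) :=
  {f | IsRoughQuasiIsometry f L M ∧ IsBoundaryExtension f (id : Boundary X → Boundary X)}

end GromovHyp

end

noncomputable section

namespace GromovHyp

open Filter

/-! ### Elementary inequalities for Gromov products. -/

section GromovProduct

variable {X : Type*} [MetricSpace X]

/-! A boundary triple has a coarsely unique center, so a map fixing the boundary coarsely fixes
centers. By starlikeness every `x` is near a point `p` of a line from `ξ` to some `η`. Uniform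
perfectness yields `ζ` such that the three Gromov products of `ξ`, `η`, `ζ` at `p` are bounded
(`IsGeodesicLine.exists_third_point`): near the endpoint toward which `p` is seen from `w`, an
annulus of radius about `exp (-ε d(p,w))` contains a `ζ` that branches off just past `p`.

Stability of quasi-geodesics (`exists_gromovProd_map_le`) makes `f p` a coarse center of the image
triple. Image sequences are equivalent to the original ones, so `f p` is also a coarse center of the
original triple (`eventually_gromovProd_le_of_map`), and `IsHyperbolic.dist_le_of_centers` bounds
`d(p, f p)`. All of this is carried out on sequences, at one common index. -/

lemma gromovProd_nonneg (w x y : X) : 0 ≤ gromovProd w x y := by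
  have := dist_triangle_right x y w
  unfold gromovProd
  linarith

lemma gromovProd_le_add_dist (v w x y : X) :
    gromovProd w x y ≤ gromovProd v x y + dist v w := by
  have h₁ := dist_triangle x v w
  have h₂ := dist_triangle y v w
  unfold gromovProd
  linarith

/-- The hyperbolic inequality in the form used to bound Gromov products from below. -/
lemma IsHyperbolic.sub_le_gromovProd {δ : ℝ} (hX : IsHyperbolic X δ) {w x y z : X} {t : ℝ}
    (h₁ : t ≤ gromovProd w x z) (h₂ : t ≤ gromovProd w z y) : t - δ ≤ gromovProd w x y :=
  (sub_le_sub_right (le_min h₁ h₂) δ).trans (hX x y z w)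

/-- The hyperbolic inequality for chains of four points. -/
lemma IsHyperbolic.sub_two_mul_le_gromovProd {δ : ℝ} (hδ : 0 ≤ δ) (hX : IsHyperbolic X δ)
    {w x y z u : X} {t : ℝ} (h₁ : t ≤ gromovProd w x y) (h₂ : t ≤ gromovProd w y z)
    (h₃ : t ≤ gromovProd w z u) : t - 2 * δ ≤ gromovProd w x u := by
  have := hX.sub_le_gromovProd (t := t - δ) (by linarith : t - δ ≤ gromovProd w x y)
    (hX.sub_le_gromovProd h₂ h₃)
  linarith

end GromovProduct

/-! ### Gromov products on the boundary. -/

section Boundary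

variable {X : Type*} [MetricSpace X]

lemma Boundary.exists_represents (ξ : Boundary X) : ∃ s, Represents s ξ := by
  induction ξ using Quot.ind with
  | mk s => exact ⟨s.1, s.2, rfl⟩

lemma Represents.tendsto_gromovProd {δ : ℝ} (hX : IsHyperbolic X δ) {s t : ℕ → X}
    {ξ : Boundary X} (hs : Represents s ξ) (ht : Represents t ξ) (w : X) :
    Tendsto (fun i => gromovProd w (s i) (t i)) atTop atTop := by
  obtain ⟨hs, rfl⟩ := hs
  obtain ⟨ht, h⟩ := ht
  exact (mk_eq_mk_iff hX _ _).1 h.symm w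

lemma boundaryProd_comm (w : X) (ξ ζ : Boundary X) :
    boundaryProd w ξ ζ = boundaryProd w ζ ξ := by
  unfold boundaryProd
  congr 1
  ext a
  constructor <;>
  · rintro ⟨x, y, hx, hy, rfl⟩
    exact ⟨y, x, hy, hx, by simp only [gromovProd_comm]⟩

lemma boundaryProd_nonneg (w : X) (ξ ζ : Boundary X) : 0 ≤ boundaryProd w ξ ζ := by
  refine le_sInf ?_
  rintro _ ⟨x, y, -, -, rfl⟩
  exact le_liminf_of_le (h := Eventually.of_forall fun i => by
    exact_mod_cast gromovProd_nonneg w (x i) (y i))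

lemma boundaryProd_le_of_frequently {w : X} {ξ ζ : Boundary X} {s t : ℕ → X}
    (hs : Represents s ξ) (ht : Represents t ζ) {r : ℝ}
    (h : ∃ᶠ i in atTop, gromovProd w (s i) (t i) ≤ r) : boundaryProd w ξ ζ ≤ r := by
  have hle : boundaryProd w ξ ζ ≤ liminf (fun i => ((gromovProd w (s i) (t i) : ℝ) : EReal)) atTop :=
    sInf_le ⟨s, t, hs, ht, rfl⟩
  refine hle.trans (liminf_le_of_frequently_le (h.mono fun i hi => ?_))
  exact_mod_cast hi

lemma eventually_lt_gromovProd {w : X} {ξ ζ : Boundary X} {s t : ℕ → X}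
    (hs : Represents s ξ) (ht : Represents t ζ) {r : ℝ} (h : (r : EReal) < boundaryProd w ξ ζ) :
    ∀ᶠ i in atTop, r < gromovProd w (s i) (t i) :=
  (eventually_lt_of_lt_liminf (h.trans_le (sInf_le ⟨s, t, hs, ht, rfl⟩))).mono
    fun i hi => by exact_mod_cast hi

/-- The infimum is nearly attained by some representatives. Passing to the prescribed ones costs `2
* δ`, as products of equivalent sequences tend to infinity. -/
lemma frequently_gromovProd_lt {δ : ℝ} (hδ : 0 ≤ δ) (hX : IsHyperbolic X δ) {w : X}
    {ξ ζ : Boundary X} {s t : ℕ → X} (hs : Represents s ξ) (ht : Represents t ζ) {r : ℝ}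
    (h : boundaryProd w ξ ζ < r) :
    ∃ᶠ i in atTop, gromovProd w (s i) (t i) < r + 2 * δ := by
  obtain ⟨_, ⟨x, y, hx, hy, rfl⟩, hr⟩ := sInf_lt_iff.1 h
  have hf := frequently_lt_of_liminf_lt (h := hr)
  refine (hf.and_eventually
    (((hx.tendsto_gromovProd hX hs w).eventually_ge_atTop (r + 2 * δ)).and
      ((ht.tendsto_gromovProd hX hy w).eventually_ge_atTop (r + 2 * δ)))).mono ?_
  rintro i ⟨h₁, h₂, h₃⟩
  have h₁ : gromovProd w (x i) (y i) < r := by exact_mod_cast h₁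
  by_contra! h₄
  linarith [hX.sub_two_mul_le_gromovProd hδ h₂ h₄ h₃]

lemma boundaryProd_self {δ : ℝ} (hX : IsHyperbolic X δ) (w : X) (ξ : Boundary X) :
    boundaryProd w ξ ξ = ⊤ := by
  refine sInf_eq_top.2 ?_
  rintro _ ⟨x, y, hx, hy, rfl⟩
  exact (EReal.tendsto_coe_nhds_top_iff.2 (hx.tendsto_gromovProd hX hy w)).liminf_eq

lemma le_boundaryProd_chain {δ : ℝ} (hδ : 0 ≤ δ) (hX : IsHyperbolic X δ) {w : X}
    {ξ₁ ξ₂ ξ₃ ξ₄ : Boundary X} {t : ℝ} (h₁ : (t : EReal) ≤ boundaryProd w ξ₁ ξ₂)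
    (h₂ : (t : EReal) ≤ boundaryProd w ξ₂ ξ₃) (h₃ : (t : EReal) ≤ boundaryProd w ξ₃ ξ₄) :
    ((t - 2 * δ : ℝ) : EReal) ≤ boundaryProd w ξ₁ ξ₄ := by
  refine le_sInf ?_
  rintro _ ⟨x, y, hx, hy, rfl⟩
  obtain ⟨u, hu⟩ := ξ₂.exists_represents
  obtain ⟨v, hv⟩ := ξ₃.exists_represents
  refine EReal.ge_of_forall_gt_iff_ge.1 fun s hs => ?_
  have hs : s < t - 2 * δ := by exact_mod_cast hs
  have hlt : ((s + 2 * δ : ℝ) : EReal) < t := by exact_mod_cast (by linarith)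
  refine le_liminf_of_le (h := ?_)
  filter_upwards [eventually_lt_gromovProd hx hu (hlt.trans_le h₁),
    eventually_lt_gromovProd hu hv (hlt.trans_le h₂),
    eventually_lt_gromovProd hv hy (hlt.trans_le h₃)] with i h₁ h₂ h₃
  have := hX.sub_two_mul_le_gromovProd hδ h₁.le h₂.le h₃.le
  exact_mod_cast (by linarith : s ≤ gromovProd w (x i) (y i))

end Boundary

/-! ### Comparison of the visual metric with `visualRho`. -/

section VisualMetric

variable {X : Type*} [MetricSpace X]

lemma visualRho_nonneg (w : X) (ε : ℝ) (ξ ζ : Boundary X) : 0 ≤ visualRho w ε ξ ζ :=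
  ENNReal.toReal_nonneg

lemma visualRho_comm (w : X) (ε : ℝ) (ξ ζ : Boundary X) :
    visualRho w ε ξ ζ = visualRho w ε ζ ξ := by
  rw [visualRho, boundaryProd_comm, visualRho]

lemma visualRho_self {δ ε : ℝ} (hε : 0 < ε) (hX : IsHyperbolic X δ) (w : X) (ξ : Boundary X) :
    visualRho w ε ξ ξ = 0 := by
  simp [visualRho, boundaryProd_self hX, EReal.coe_mul_top_of_pos hε]

lemma exp_le_visualRho {w : X} {ε t : ℝ} (hε : 0 < ε) {ξ ζ : Boundary X}
    (h : boundaryProd w ξ ζ ≤ t) : Real.exp (-(ε * t)) ≤ visualRho w ε ξ ζ := by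
  have hε' : (0 : EReal) ≤ ε := by exact_mod_cast hε.le
  have h₁ : EReal.exp (-((ε : EReal) * t)) ≤ EReal.exp (-((ε : EReal) * boundaryProd w ξ ζ)) :=
    EReal.exp_monotone (EReal.neg_le_neg_iff.2 (mul_le_mul_of_nonneg_left h hε'))
  -- Finiteness is needed because `toReal` sends `∞` to `0`.
  have h₂ : EReal.exp (-((ε : EReal) * boundaryProd w ξ ζ)) ≤ 1 := by
    rw [EReal.exp_le_one_iff, EReal.neg_le_zero]
    exact mul_nonneg hε' (boundaryProd_nonneg w ξ ζ)
  have h₃ := ENNReal.toReal_mono (ne_top_of_le_ne_top ENNReal.one_ne_top h₂) h₁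
  rwa [← EReal.coe_mul, ← EReal.coe_neg, EReal.exp_coe,
    ENNReal.toReal_ofReal (Real.exp_pos _).le] at h₃

lemma visualRho_le_exp {w : X} {ε t : ℝ} (hε : 0 < ε) {ξ ζ : Boundary X}
    (h : (t : EReal) ≤ boundaryProd w ξ ζ) : visualRho w ε ξ ζ ≤ Real.exp (-(ε * t)) := by
  have hε' : (0 : EReal) ≤ ε := by exact_mod_cast hε.le
  have h₁ : EReal.exp (-((ε : EReal) * boundaryProd w ξ ζ)) ≤ EReal.exp (-((ε : EReal) * t)) :=
    EReal.exp_monotone (EReal.neg_le_neg_iff.2 (mul_le_mul_of_nonneg_left h hε'))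
  rw [← EReal.coe_mul, ← EReal.coe_neg, EReal.exp_coe] at h₁
  have h₃ := ENNReal.toReal_mono ENNReal.ofReal_ne_top h₁
  rwa [ENNReal.toReal_ofReal (Real.exp_pos _).le] at h₃

lemma lt_boundaryProd {w : X} {ε t : ℝ} (hε : 0 < ε) {ξ ζ : Boundary X}
    (h : visualRho w ε ξ ζ < Real.exp (-(ε * t))) : (t : EReal) < boundaryProd w ξ ζ := by
  by_contra! h'
  exact h.not_ge (exp_le_visualRho hε h')

lemma boundaryProd_lt {w : X} {ε t : ℝ} (hε : 0 < ε) {ξ ζ : Boundary X}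
    (h : Real.exp (-(ε * t)) < visualRho w ε ξ ζ) : boundaryProd w ξ ζ < t := by
  by_contra! h'
  exact h.not_ge (visualRho_le_exp hε h')

/-- The loss `2 * δ` in the four-point inequality becomes the factor `exp (2δε)`, which is at most
`2` since `2δε < 2/5 < log 2`. This is the hypothesis of Frink's metrization lemma. -/
lemma visualRho_chain {δ ε : ℝ} (hδ : 0 ≤ δ) (hε : 0 < ε) (hεδ : ε * (5 * δ) < 1)
    (hX : IsHyperbolic X δ) (w : X) (ξ₁ ξ₂ ξ₃ ξ₄ : Boundary X) :
    visualRho w ε ξ₁ ξ₄ ≤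
      2 * max (visualRho w ε ξ₁ ξ₂) (max (visualRho w ε ξ₂ ξ₃) (visualRho w ε ξ₃ ξ₄)) := by
  -- The maximum may be `0`, while `b / 2` is positive and so has the form `exp (-(ε * t))`.
  refine le_of_forall_gt_imp_ge_of_dense fun b hb => ?_
  set M := max (visualRho w ε ξ₁ ξ₂) (max (visualRho w ε ξ₂ ξ₃) (visualRho w ε ξ₃ ξ₄)) with hM
  have hM0 : 0 ≤ M := (visualRho_nonneg _ _ _ _).trans (le_max_left _ _)
  have hb0 : 0 < b / 2 := by linarith
  have hMb : M < b / 2 := by linarith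
  obtain ⟨t, ht⟩ : ∃ t, Real.exp (-(ε * t)) = b / 2 :=
    ⟨-Real.log (b / 2) / ε, by rw [mul_div_cancel₀ _ hε.ne', neg_neg, Real.exp_log hb0]⟩
  rw [← ht, hM, max_lt_iff, max_lt_iff] at hMb
  have h := visualRho_le_exp hε (le_boundaryProd_chain hδ hX (lt_boundaryProd hε hMb.1).le
    (lt_boundaryProd hε hMb.2.1).le (lt_boundaryProd hε hMb.2.2).le)
  have h₂ : Real.exp (ε * (2 * δ)) ≤ 2 := by
    rw [← Real.le_log_iff_exp_le two_pos]
    linarith [Real.log_two_gt_d9]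
  have h₃ : Real.exp (-(ε * (t - 2 * δ))) = Real.exp (ε * (2 * δ)) * (b / 2) := by
    rw [← ht, ← Real.exp_add]
    ring_nf
  rw [h₃] at h
  nlinarith

lemma visualDist_le_visualRho (w : X) (ε : ℝ) (ξ ζ : Boundary X) :
    visualDist w ε ξ ζ ≤ visualRho w ε ξ ζ := by
  refine csInf_le ⟨0, ?_⟩ ⟨1, fun i => if i = 0 then ξ else ζ, le_rfl, rfl, rfl, by simp⟩
  rintro _ ⟨n, c, -, -, -, rfl⟩
  exact Finset.sum_nonneg fun i _ => visualRho_nonneg _ _ _ _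

/-- The chain lemma: the visual metric is bi-Lipschitz equivalent to `visualRho`. -/
lemma visualRho_le_two_mul_visualDist {δ ε : ℝ} (hδ : 0 ≤ δ) (hε : 0 < ε)
    (hεδ : ε * (5 * δ) < 1) (hX : IsHyperbolic X δ) (w : X) (ξ ζ : Boundary X) :
    visualRho w ε ξ ζ ≤ 2 * visualDist w ε ξ ζ := by
  let ρ : Boundary X → Boundary X → NNReal := fun a b => ⟨visualRho w ε a b, visualRho_nonneg _ _ _ _⟩
  have hself : ∀ a, ρ a a = 0 := fun a => NNReal.eq (visualRho_self hε hX w a)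
  have hcomm : ∀ a b, ρ a b = ρ b a := fun a b => NNReal.eq (visualRho_comm w ε a b)
  have hchain : ∀ a b c d, ρ a d ≤ 2 * max (ρ a b) (max (ρ b c) (ρ c d)) := fun a b c d =>
    visualRho_chain hδ hε hεδ hX w a b c d
  let _ : PseudoMetricSpace (Boundary X) := PseudoMetricSpace.ofPreNNDist ρ hself hcomm
  have hle : ∀ a b, dist a b ≤ visualRho w ε a b := fun a b =>
    PseudoMetricSpace.dist_ofPreNNDist_le ρ hself hcomm a b
  have h : visualRho w ε ξ ζ ≤ 2 * dist ξ ζ :=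
    PseudoMetricSpace.le_two_mul_dist_ofPreNNDist ρ hself hcomm hchain ξ ζ
  refine h.trans (mul_le_mul_of_nonneg_left ?_ two_pos.le)
  -- The Frink metric satisfies the triangle inequality and lies below `visualRho`, hence below
  -- every chain sum.
  refine le_csInf ⟨_, 1, fun i => if i = 0 then ξ else ζ, le_rfl, rfl, rfl, rfl⟩ ?_
  rintro _ ⟨n, c, -, rfl, rfl, rfl⟩
  exact (dist_le_range_sum_dist c n).trans (Finset.sum_le_sum fun i _ => hle _ _)

end VisualMetric

/-! ### Third boundary points from uniform perfectness. -/

section ThirdPoint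

variable {X : Type*} [MetricSpace X]

/-- If `x` lies coarsely on a ray from `w` to the boundary point `ξ` and on a line from `ξ` to `η`,
then uniform perfectness provides a third boundary point such that `x` is a coarse center of the
resulting triple. -/
lemma IsUniformlyPerfect.exists_third_point {δ ε C : ℝ} (hδ : 0 ≤ δ) (hε : 0 < ε)
    (hεδ : ε * (5 * δ) < 1) (hX : IsHyperbolic X δ) {w x : X}
    (hC : IsUniformlyPerfect (visualDist w ε) C) {ξ η : Boundary X} {u v : ℕ → X}
    (hu : Represents u ξ) (hv : Represents v η)
    (huv : ∀ᶠ n in atTop, gromovProd x (u n) (v n) ≤ 0)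
    (huw : ∀ᶠ n in atTop, gromovProd x (u n) w ≤ δ) :
    ∃ (ζ : Boundary X) (z : ℕ → X), Represents z ζ ∧
      ∃ᶠ n in atTop, gromovProd x (u n) (z n) ≤ 6 * δ + 2 + Real.log (2 * C) / ε ∧
        gromovProd x (v n) (z n) ≤ δ := by
  obtain ⟨hC1, hC⟩ := hC
  set d := dist x w with hd
  -- The margin `δ + 1` forces `(ξ|ζ)_x > δ` below; the radius `E / 2` absorbs the factor `2`
  -- between `visualRho` and `visualDist`.
  set E := Real.exp (-(ε * (d + (δ + 1)))) with hE
  have hE0 : 0 < E := Real.exp_pos _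
  have hξη : boundaryProd w ξ η ≤ (d : ℝ) := by
    refine boundaryProd_le_of_frequently hu hv (Eventually.frequently ?_)
    filter_upwards [huv] with n hn
    linarith [gromovProd_le_add_dist x w (u n) (v n)]
  have hfar : E / 2 ≤ visualDist w ε ξ η := by
    have h₁ := exp_le_visualRho hε hξη
    have h₂ := visualRho_le_two_mul_visualDist hδ hε hεδ hX w ξ η
    have h₃ : E ≤ Real.exp (-(ε * d)) := Real.exp_le_exp.2 (by nlinarith)
    linarith
  obtain ⟨ζ, h₁, h₂⟩ := hC ξ (E / 2) (by positivity) ⟨η, hfar⟩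
  have hlow : ((d + (δ + 1) : ℝ) : EReal) < boundaryProd w ξ ζ := by
    refine lt_boundaryProd hε ?_
    linarith [visualRho_le_two_mul_visualDist hδ hε hεδ hX w ξ ζ]
  have hup : boundaryProd w ξ ζ < ((d + (δ + 1) + Real.log (2 * C) / ε + 1 : ℝ) : EReal) := by
    refine boundaryProd_lt hε (lt_of_lt_of_le ?_ (h₁.trans (visualDist_le_visualRho w ε ξ ζ)))
    have h2C : 0 < 2 * C := by linarith
    have hE' : E / 2 / C = Real.exp (-(ε * (d + (δ + 1))) - Real.log (2 * C)) := by
      rw [Real.exp_sub, Real.exp_log h2C, ← hE, div_div]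
    rw [hE', Real.exp_lt_exp]
    have : ε * (Real.log (2 * C) / ε) = Real.log (2 * C) := mul_div_cancel₀ _ hε.ne'
    nlinarith
  obtain ⟨z, hz⟩ := ζ.exists_represents
  refine ⟨ζ, z, hz, ((frequently_gromovProd_lt hδ hX hu hz hup).and_eventually
    ((eventually_lt_gromovProd hu hz hlow).and (huv.and huw))).mono ?_⟩
  rintro n ⟨hn₁, hn₂, hn₃, hn₄⟩
  -- The products `(u n|w)_x` and `(u n|x)_w` add up to `d`.
  have hux : d - δ ≤ gromovProd w (u n) x := by
    simp only [gromovProd, dist_comm w x] at hn₄ ⊢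
    linarith
  have hzx : d - δ - δ ≤ gromovProd w (z n) x :=
    hX.sub_le_gromovProd (z := u n) (by rw [gromovProd_comm]; linarith) hux
  have hlarge : δ < gromovProd x (u n) (z n) := by
    have := gromovProd_le_add_dist x w (u n) (z n)
    linarith
  constructor
  · simp only [gromovProd] at hn₁ hux hzx ⊢
    linarith
  -- Otherwise `(u n|z n)_x` and `(z n|v n)_x` both exceed `δ`, so `(u n|v n)_x > 0`.
  · by_contra! h
    rcases min_choice (gromovProd x (u n) (z n)) (gromovProd x (z n) (v n)) with h' | h' <;>
    · have := hX (u n) (v n) (z n) x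
      rw [h'] at this
      linarith [gromovProd_comm x (v n) (z n)]

lemma IsGeodesicLine.gromovProd_eq_zero {γ : ℝ → X} {ξ η : Boundary X}
    (hγ : IsGeodesicLine γ ξ η) {r s t : ℝ} (hrs : r ≤ s) (hst : s ≤ t) :
    gromovProd (γ s) (γ r) (γ t) = 0 := by
  simp only [gromovProd, hγ.1]
  rw [abs_of_nonpos (by linarith), abs_of_nonneg (by linarith), abs_of_nonpos (by linarith)]
  ring

/-- Any point `w` projects coarsely to one of the two rays into which a point divides a line. -/
lemma IsGeodesicLine.eventually_le_or {δ : ℝ} (hX : IsHyperbolic X δ)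
    {γ : ℝ → X} {ξ η : Boundary X} (hγ : IsGeodesicLine γ ξ η) (t : ℝ) (w : X) :
    (∀ᶠ n : ℕ in atTop, gromovProd (γ t) (γ (-(n : ℝ))) w ≤ δ) ∨
      ∀ᶠ n : ℕ in atTop, gromovProd (γ t) (γ n) w ≤ δ := by
  obtain ⟨N, hN⟩ := exists_nat_ge |t|
  have hN := abs_le.1 hN
  by_contra! h
  obtain ⟨h₁, h₂⟩ := h
  obtain ⟨m, hm, hmδ⟩ := Filter.frequently_atTop.1 h₁ N
  obtain ⟨n, hn, hnδ⟩ := Filter.frequently_atTop.1 h₂ N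
  have hm : (N : ℝ) ≤ m := by exact_mod_cast hm
  have hn : (N : ℝ) ≤ n := by exact_mod_cast hn
  have h₀ := hγ.gromovProd_eq_zero (r := -(m : ℝ)) (s := t) (t := n) (by linarith) (by linarith)
  rw [gromovProd_comm] at hnδ
  -- The two failures occur at unrelated indices `m` and `n`, but the product of `γ (-m)` and `γ n`
  -- at `γ t` vanishes anyway.
  have := (lt_min hmδ hnδ).trans_le (sub_le_iff_le_add.1 (hX (γ (-(m : ℝ))) (γ n) w (γ t)))
  linarith

/-- In a space with uniformly perfect boundary, each point of a geodesic line is a coarse center of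
an ideal triple containing the endpoints of the line. -/
lemma IsGeodesicLine.exists_third_point {δ ε C : ℝ} (hδ : 0 ≤ δ) (hε : 0 < ε)
    (hεδ : ε * (5 * δ) < 1) (hX : IsHyperbolic X δ) {w : X}
    (hC : IsUniformlyPerfect (visualDist w ε) C) {γ : ℝ → X} {ξ η : Boundary X}
    (hγ : IsGeodesicLine γ ξ η) (t : ℝ) :
    ∃ (ζ : Boundary X) (z : ℕ → X), Represents z ζ ∧
      ∃ᶠ n : ℕ in atTop, gromovProd (γ t) (γ (-(n : ℝ))) (γ n) = 0 ∧
        gromovProd (γ t) (γ (-(n : ℝ))) (z n) ≤ 6 * δ + 2 + Real.log (2 * C) / ε ∧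
        gromovProd (γ t) (γ n) (z n) ≤ 6 * δ + 2 + Real.log (2 * C) / ε := by
  have hlog : 0 ≤ Real.log (2 * C) / ε := div_nonneg (Real.log_nonneg (by linarith [hC.1])) hε.le
  have h₀ : ∀ᶠ n : ℕ in atTop, gromovProd (γ t) (γ (-(n : ℝ))) (γ n) = 0 := by
    obtain ⟨N, hN⟩ := exists_nat_ge |t|
    have hN := abs_le.1 hN
    filter_upwards [eventually_ge_atTop N] with n hn
    have hn : (N : ℝ) ≤ n := by exact_mod_cast hn
    exact hγ.gromovProd_eq_zero (by linarith) (by linarith)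
  rcases hγ.eventually_le_or hX t w with h | h
  · obtain ⟨ζ, z, hz, hf⟩ := hC.exists_third_point hδ hε hεδ hX hγ.2.1 hγ.2.2
      (h₀.mono fun n hn => hn.le) h
    exact ⟨ζ, z, hz, (hf.and_eventually h₀).mono fun n hn =>
      ⟨hn.2, hn.1.1, hn.1.2.trans (by linarith)⟩⟩
  · obtain ⟨ζ, z, hz, hf⟩ := hC.exists_third_point hδ hε hεδ hX hγ.2.2 hγ.2.1
      (h₀.mono fun n hn => (gromovProd_comm _ _ _).trans_le hn.le) h
    exact ⟨ζ, z, hz, (hf.and_eventually h₀).mono fun n hn =>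
      ⟨hn.2, hn.1.2.trans (by linarith), hn.1.1⟩⟩

end ThirdPoint

/-! ### Stability of quasi-geodesics. -/

section Morse

/-- A `(L, M)`-quasi-geodesic, not necessarily continuous, parametrized by `[0, T]`. -/
def IsQuasiGeodesic {X : Type*} [MetricSpace X] (q : ℝ → X) (T L M : ℝ) : Prop :=
  ∀ s ∈ Set.Icc (0 : ℝ) T, ∀ t ∈ Set.Icc (0 : ℝ) T,
    L⁻¹ * |s - t| - M ≤ dist (q s) (q t) ∧ dist (q s) (q t) ≤ L * |s - t| + M

lemma IsQuasiGeodesic.abs_sub_le {X : Type*} [MetricSpace X] {q : ℝ → X} {T L M : ℝ}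
    (hL : 1 ≤ L) (hq : IsQuasiGeodesic q T L M) {s t : ℝ} (hs : s ∈ Set.Icc 0 T)
    (ht : t ∈ Set.Icc 0 T) : |s - t| ≤ L * (dist (q s) (q t) + M) := by
  have h := (hq s hs t ht).1
  have hL0 : 0 < L := by linarith
  have : L * (L⁻¹ * |s - t|) = |s - t| := mul_inv_cancel_left₀ hL0.ne' _
  nlinarith

/-- `g` restricted to `[0, S]` is a geodesic segment. -/
def IsGeodesicOn {X : Type*} [MetricSpace X] (g : ℝ → X) (S : ℝ) : Prop :=
  ∀ s ∈ Set.Icc (0 : ℝ) S, ∀ t ∈ Set.Icc (0 : ℝ) S, dist (g s) (g t) = |s - t|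

lemma IsGeodesicOn.gromovProd_eq_zero {X : Type*} [MetricSpace X] {g : ℝ → X} {S r s t : ℝ}
    (hg : IsGeodesicOn g S) (hr : 0 ≤ r) (hrs : r ≤ s) (hst : s ≤ t) (ht : t ≤ S) :
    gromovProd (g s) (g r) (g t) = 0 := by
  have hr' : r ∈ Set.Icc 0 S := ⟨hr, by linarith⟩
  have hs' : s ∈ Set.Icc 0 S := ⟨by linarith, by linarith⟩
  have ht' : t ∈ Set.Icc 0 S := ⟨by linarith, ht⟩
  rw [gromovProd, hg r hr' s hs', hg t ht' s hs', hg r hr' t ht', abs_of_nonpos (by linarith),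
    abs_of_nonneg (by linarith), abs_of_nonpos (by linarith)]
  ring

/-- Repeated bisection makes the loss logarithmic in the number of steps. -/
lemma IsHyperbolic.sub_mul_le_gromovProd_chain {X : Type*} [MetricSpace X] {δ : ℝ}
    (hX : IsHyperbolic X δ) {w : X} {t : ℝ} (k : ℕ) (p : ℕ → X)
    (h : ∀ i < 2 ^ k, t ≤ gromovProd w (p i) (p (i + 1))) :
    t - k * δ ≤ gromovProd w (p 0) (p (2 ^ k)) := by
  induction k generalizing p with
  | zero => simpa using h 0 (by simp)
  | succ k ih =>
    have h₁ := ih p fun i hi => h i (by rw [pow_succ]; omega)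
    have h₂ := ih (fun i => p (2 ^ k + i)) fun i hi => h (2 ^ k + i) (by rw [pow_succ]; omega)
    have h₃ := hX.sub_le_gromovProd h₁ h₂
    rw [← mul_two, ← pow_succ] at h₃
    push_cast
    linarith

/-- Paths avoiding a ball of radius `D` around `w` have length exponential in `D`. -/
lemma IsQuasiGeodesic.le_gromovProd {X : Type*} [MetricSpace X] {δ L M T D : ℝ} (hL : 1 ≤ L)
    (hX : IsHyperbolic X δ) {q : ℝ → X} (hq : IsQuasiGeodesic q T L M) {w : X}
    (hD : ∀ r ∈ Set.Icc 0 T, D ≤ dist (q r) w) {s t : ℝ} (hs : s ∈ Set.Icc 0 T)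
    (ht : t ∈ Set.Icc 0 T) {k : ℕ} (hk : |s - t| ≤ 2 ^ k) :
    D - (L + M) / 2 - k * δ ≤ gromovProd w (q s) (q t) := by
  have h2 : (0 : ℝ) < 2 ^ k := by positivity
  -- Subdivision into `2 ^ k` parameter steps of length at most `1`: consecutive points are at most
  -- `L + M` apart and at least `D` from `w`.
  set p : ℕ → ℝ := fun i => s + (i / 2 ^ k : ℝ) * (t - s) with hp
  have hmem : ∀ i ≤ 2 ^ k, p i ∈ Set.Icc 0 T := by
    intro i hi
    have hi' : (i : ℝ) ≤ 2 ^ k := by exact_mod_cast hi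
    exact (convex_Icc 0 T).add_smul_sub_mem hs ht ⟨by positivity, (div_le_one h2).2 hi'⟩
  have h := hX.sub_mul_le_gromovProd_chain (w := w) (t := D - (L + M) / 2) k (fun i => q (p i)) ?_
  · simpa [hp, h2.ne'] using h
  · intro i hi
    have h₁ := hmem i hi.le
    have h₂ := hmem (i + 1) hi
    have h₃ := (hq _ h₁ _ h₂).2
    have h₄ : |p i - p (i + 1)| ≤ 1 := by
      have : p i - p (i + 1) = (s - t) / 2 ^ k := by
        simp only [hp]
        push_cast
        ring
      rw [this, abs_div, abs_of_pos h2]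
      exact (div_le_one h2).2 hk
    have h₅ := hD _ h₁
    have h₆ := hD _ h₂
    simp only [gromovProd]
    nlinarith

lemma exists_forall_two_pow_le (a b : ℝ) : ∃ k₀ : ℕ, ∀ k : ℕ, (2 : ℝ) ^ k ≤ a + b * k → k ≤ k₀ := by
  have h₀ := tendsto_pow_const_div_const_pow_of_one_lt 0 (one_lt_two : (1 : ℝ) < 2)
  have h₁ := tendsto_pow_const_div_const_pow_of_one_lt 1 (one_lt_two : (1 : ℝ) < 2)
  have h := (h₀.const_mul a).add (h₁.const_mul b)
  obtain ⟨k₀, hk₀⟩ := eventually_atTop.1 (h.eventually_lt_const (by simp : a * 0 + b * 0 < (1 : ℝ)))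
  refine ⟨k₀, fun k hk => ?_⟩
  by_contra! hlt
  have h₂ := hk₀ k hlt.le
  have h2 : (0 : ℝ) < 2 ^ k := by positivity
  rw [mul_div_assoc', mul_div_assoc', ← add_div, div_lt_one h2] at h₂
  simp at h₂
  linarith

/-- Geodesics stay close to quasi-geodesics with the same endpoints. -/
theorem exists_dist_geodesic_quasiGeodesic_le (δ L M : ℝ) (hδ : 0 ≤ δ) (hL : 1 ≤ L) (hM : 0 ≤ M) :
    ∃ D₀ : ℝ, 0 ≤ D₀ ∧ ∀ (X : Type*) [MetricSpace X], IsHyperbolic X δ →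
      ∀ (q g : ℝ → X) (T S : ℝ), 0 ≤ T → 0 ≤ S → IsQuasiGeodesic q T L M → IsGeodesicOn g S →
      g 0 = q 0 → g S = q T → ∀ t ∈ Set.Icc 0 S, ∃ s ∈ Set.Icc 0 T, dist (g t) (q s) ≤ D₀ := by
  -- `1 / 2` comes from `hend`, `(L + M) / 2` from the subdivision, `2 * δ` from a chain of four
  -- points.
  set A := 1 / 2 + (L + M) / 2 + 2 * δ with hA
  have hA0 : 0 ≤ A := by positivity
  obtain ⟨k₀, hk₀⟩ := exists_forall_two_pow_le (L * (6 * (A + δ) + 2 + M)) (L * (6 * δ))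
  refine ⟨A + (k₀ + 1) * δ + 1, by positivity, ?_⟩
  intro X _ hX q g T S hT hS hq hg h0 h1 t ht
  set Q := q '' Set.Icc 0 T with hQ
  have hQne : Q.Nonempty := ⟨q 0, 0, ⟨le_rfl, hT⟩, rfl⟩
  have hcont : ContinuousOn (fun t => Metric.infDist (g t) Q) (Set.Icc 0 S) := by
    refine (Metric.continuous_infDist_pt Q).comp_continuousOn ?_
    refine (LipschitzOnWith.of_dist_le_mul (K := 1) fun x hx y hy => ?_).continuousOn
    rw [hg x hx y hy, Real.dist_eq, NNReal.coe_one, one_mul]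
  -- `g m` is a point of the geodesic farthest from the quasi-geodesic. The detour from `g a` to `g
  -- b` via `q` avoids the `D`-ball around it and has parameter length only linear in `D`, which
  -- bounds `D`.
  obtain ⟨m, hm, hmax⟩ := isCompact_Icc.exists_isMaxOn ⟨t, ht⟩ hcont
  set D := Metric.infDist (g m) Q with hD
  have hD0 : 0 ≤ D := Metric.infDist_nonneg
  have hnear : ∀ r ∈ Set.Icc 0 S, ∃ s ∈ Set.Icc 0 T, dist (g r) (q s) < D + 1 := by
    intro r hr
    obtain ⟨_, ⟨s, hs, rfl⟩, h⟩ := (Metric.infDist_lt_iff hQne).1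
      (lt_of_le_of_lt (hmax hr) (lt_add_one D))
    exact ⟨s, hs, h⟩
  have hfar : ∀ r ∈ Set.Icc 0 T, D ≤ dist (q r) (g m) := fun r hr => by
    rw [dist_comm]
    exact Metric.infDist_le_dist_of_mem ⟨r, hr, rfl⟩
  have hend : ∀ r ∈ Set.Icc 0 S, ((∃ s ∈ Set.Icc 0 T, g r = q s) ∨ |m - r| = 2 * D) →
      ∃ s ∈ Set.Icc 0 T, dist (g r) (q s) ≤ D + 1 ∧ D - 1 / 2 ≤ gromovProd (g m) (g r) (q s) := by
    rintro r hr (⟨s, hs, h⟩ | h)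
    · refine ⟨s, hs, by rw [h, dist_self]; linarith, ?_⟩
      have := hfar s hs
      rw [gromovProd, h, dist_self]
      linarith
    · obtain ⟨s, hs, h'⟩ := hnear r hr
      refine ⟨s, hs, h'.le, ?_⟩
      have := hfar s hs
      rw [gromovProd, dist_comm (g r) (g m), hg m hm r hr, h]
      linarith
  obtain ⟨a, ha, ham, ham', hae⟩ : ∃ a ∈ Set.Icc 0 S, a ≤ m ∧ |m - a| ≤ 2 * D ∧
      ((∃ s ∈ Set.Icc 0 T, g a = q s) ∨ |m - a| = 2 * D) := by
    rcases le_total m (2 * D) with h | h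
    · exact ⟨0, ⟨le_rfl, hS⟩, hm.1, by rwa [sub_zero, abs_of_nonneg hm.1],
        Or.inl ⟨0, ⟨le_rfl, hT⟩, h0⟩⟩
    · have : |m - (m - 2 * D)| = 2 * D := by rw [sub_sub_cancel, abs_of_nonneg (by linarith)]
      exact ⟨m - 2 * D, ⟨by linarith, by linarith [hm.2]⟩, by linarith, this.le, Or.inr this⟩
  obtain ⟨b, hb, hbm, hbm', hbe⟩ : ∃ b ∈ Set.Icc 0 S, m ≤ b ∧ |m - b| ≤ 2 * D ∧
      ((∃ s ∈ Set.Icc 0 T, g b = q s) ∨ |m - b| = 2 * D) := by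
    rcases le_total (S - m) (2 * D) with h | h
    · exact ⟨S, ⟨hS, le_rfl⟩, hm.2, by rw [abs_of_nonpos (by linarith [hm.2])]; linarith,
        Or.inl ⟨T, ⟨hT, le_rfl⟩, h1⟩⟩
    · have : |m - (m + 2 * D)| = 2 * D := by
        rw [sub_add_cancel_left, abs_neg, abs_of_nonneg (by linarith)]
      exact ⟨m + 2 * D, ⟨by linarith [hm.1], by linarith⟩, by linarith, this.le, Or.inr this⟩
  obtain ⟨s, hs, hs₁, hs₂⟩ := hend a ha hae
  obtain ⟨s', hs', hs'₁, hs'₂⟩ := hend b hb hbe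
  have hab : gromovProd (g m) (g a) (g b) = 0 := hg.gromovProd_eq_zero ha.1 ham hbm hb.2
  have hss : |s - s'| ≤ L * (6 * D + 2 + M) := by
    refine (hq.abs_sub_le hL hs hs').trans (mul_le_mul_of_nonneg_left ?_ (by linarith))
    have h₁ := dist_triangle4 (q s) (g a) (g b) (q s')
    have h₂ := dist_triangle (g a) (g m) (g b)
    rw [dist_comm (g a) (g m), hg m hm a ha, hg m hm b hb] at h₂
    rw [dist_comm (q s) (g a)] at h₁
    linarith
  have hbound : ∀ k : ℕ, |s - s'| ≤ 2 ^ k → D ≤ A + k * δ := by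
    intro k hk
    have h := hq.le_gromovProd hL hX hfar hs hs' hk
    by_contra! hlt
    have hkδ : 0 ≤ k * δ := by positivity
    rw [gromovProd_comm] at hs'₂
    have := hX.sub_two_mul_le_gromovProd hδ (t := D - (L + M) / 2 - 1 / 2 - k * δ)
      (by linarith : _ ≤ gromovProd (g m) (g a) (q s)) (by linarith)
      (by linarith : _ ≤ gromovProd (g m) (q s') (g b))
    linarith
  have hDle : D ≤ A + (k₀ + 1) * δ := by
    have hex : ∃ k : ℕ, |s - s'| ≤ 2 ^ k :=
      (pow_unbounded_of_one_lt _ one_lt_two).imp fun _ h => h.le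
    -- Minimality of `k = j + 1` gives `2 ^ j < |s - s'|`, and `hbound` makes the right side at most
    -- linear in `j`.
    obtain ⟨k, hk, hmin⟩ : ∃ k : ℕ, |s - s'| ≤ 2 ^ k ∧ ∀ j < k, ¬ |s - s'| ≤ 2 ^ j := by
      classical exact ⟨Nat.find hex, Nat.find_spec hex, fun j => Nat.find_min hex⟩
    have hDk := hbound k hk
    cases k with
    | zero =>
      have : 0 ≤ (k₀ + 1) * δ := by positivity
      simp only [Nat.cast_zero, zero_mul, add_zero] at hDk
      linarith
    | succ j =>
      have hj := not_le.1 (hmin j (Nat.lt_succ_self j))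
      push_cast at hDk
      have hjk : j ≤ k₀ := by
        refine hk₀ j (hj.le.trans (hss.trans ?_))
        have : L * (6 * D) ≤ L * (6 * (A + (j + 1) * δ)) := by gcongr
        linarith
      have : (j : ℝ) ≤ k₀ := by exact_mod_cast hjk
      nlinarith
  obtain ⟨r, hr, h⟩ := hnear t ht
  exact ⟨r, hr, by linarith⟩

/-- Stability of quasi-geodesics: points of a quasi-geodesic have bounded Gromov product with
respect to its endpoints. -/
theorem exists_gromovProd_quasiGeodesic_le (δ L M : ℝ) (hδ : 0 ≤ δ) (hL : 1 ≤ L) (hM : 0 ≤ M) :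
    ∃ R : ℝ, ∀ (X : Type*) [MetricSpace X], IsGeodesicSpace X → IsHyperbolic X δ →
      ∀ (q : ℝ → X) (T : ℝ), 0 ≤ T → IsQuasiGeodesic q T L M →
      ∀ r ∈ Set.Icc 0 T, gromovProd (q r) (q 0) (q T) ≤ R := by
  obtain ⟨D₀, hD₀, H⟩ := exists_dist_geodesic_quasiGeodesic_le δ L M hδ hL hM
  refine ⟨L * (L * (2 * D₀ + 2 + M)) + M + D₀, ?_⟩
  intro X _ hgeo hX q T hT hq r hr
  obtain ⟨g, h0, h1, hg⟩ := hgeo (q 0) (q T)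
  set S := dist (q 0) (q T) with hS
  have hS0 : 0 ≤ S := dist_nonneg
  have hg : IsGeodesicOn g S := hg
  have H := H X hX q g T S hT hS0 hq hg h0 h1
  -- As `q` need not be continuous, the supremum of `A` replaces a connectedness argument: within
  -- distance `2` on `g` there are points close to `q` before and after parameter `r`.
  set A := {t | t ∈ Set.Icc 0 S ∧ ∃ s ∈ Set.Icc 0 r, dist (g t) (q s) ≤ D₀} with hA
  have hA0 : (0 : ℝ) ∈ A :=
    ⟨⟨le_rfl, hS0⟩, 0, ⟨le_rfl, hr.1⟩, by rwa [h0, dist_self]⟩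
  have hAb : BddAbove A := ⟨S, fun t ht => ht.1.2⟩
  have hle : sSup A ≤ S := csSup_le ⟨0, hA0⟩ fun t ht => ht.1.2
  have hge : 0 ≤ sSup A := le_csSup hAb hA0
  obtain ⟨t₁, ⟨ht₁, s, hs, hst⟩, hlt⟩ := exists_lt_of_lt_csSup ⟨0, hA0⟩ (sub_one_lt (sSup A))
  have ht₁A : t₁ ≤ sSup A := le_csSup hAb ⟨ht₁, s, hs, hst⟩
  obtain ⟨t₂, ht₂, ht₁₂, s', hs', hst'⟩ : ∃ t₂ ∈ Set.Icc 0 S, |t₁ - t₂| ≤ 2 ∧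
      ∃ s' ∈ Set.Icc r T, dist (g t₂) (q s') ≤ D₀ := by
    rcases le_or_gt S (sSup A + 1) with h | h
    · refine ⟨S, ⟨hS0, le_rfl⟩, ?_, T, ⟨hr.2, le_rfl⟩, by rwa [h1, dist_self]⟩
      rw [abs_le]
      constructor <;> linarith
    · have hmem : sSup A + 1 ∈ Set.Icc 0 S := ⟨by linarith, h.le⟩
      obtain ⟨s', hs', hd⟩ := H _ hmem
      refine ⟨_, hmem, by rw [abs_le]; constructor <;> linarith, s', ⟨?_, hs'.2⟩, hd⟩
      by_contra! hlt
      linarith [le_csSup hAb (show sSup A + 1 ∈ A from ⟨hmem, s', ⟨hs'.1, hlt.le⟩, hd⟩)]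
  have hsT : s ∈ Set.Icc 0 T := ⟨hs.1, hs.2.trans hr.2⟩
  have hsT' : s' ∈ Set.Icc 0 T := ⟨hr.1.trans hs'.1, hs'.2⟩
  have h₁ : |r - s| ≤ L * (2 * D₀ + 2 + M) := by
    have h₁ : |r - s| ≤ |s - s'| := by
      rw [abs_of_nonneg (by linarith [hs.2]), abs_of_nonpos (by linarith [hs.2, hs'.1])]
      linarith [hs'.1]
    refine h₁.trans ((hq.abs_sub_le hL hsT hsT').trans ?_)
    have h₂ := dist_triangle4 (q s) (g t₁) (g t₂) (q s')
    rw [hg _ ht₁ _ ht₂, dist_comm (q s) (g t₁)] at h₂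
    exact mul_le_mul_of_nonneg_left (by linarith) (by linarith)
  have h₂ : dist (q r) (q s) ≤ L * (L * (2 * D₀ + 2 + M)) + M := by
    have := mul_le_mul_of_nonneg_left h₁ (by linarith : 0 ≤ L)
    linarith [(hq r hr s hsT).2]
  have h₃ := gromovProd_le_add_dist (g t₁) (q r) (q 0) (q T)
  have h₄ := hg.gromovProd_eq_zero le_rfl ht₁.1 ht₁.2 le_rfl
  rw [h0, h1] at h₄
  have h₅ := dist_triangle_right (g t₁) (q r) (q s)
  linarith

/-- The Gromov product of two points bounds the distance to any geodesic between them. -/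
lemma IsGeodesicOn.exists_dist_le {X : Type*} [MetricSpace X] {δ : ℝ} (hX : IsHyperbolic X δ)
    {a b : X} {g : ℝ → X} (hg : IsGeodesicOn g (dist a b)) (h0 : g 0 = a) (h1 : g (dist a b) = b)
    (x : X) : ∃ s ∈ Set.Icc 0 (dist a b), dist x (g s) ≤ gromovProd x a b + 2 * δ := by
  -- The comparison point `p` lies at distance `(b|x)_a` from `a`; then `(a|p)_x` and `(p|b)_x` both
  -- equal the mean of `d(x,p)` and `(a|b)_x`.
  have hs : gromovProd a b x ∈ Set.Icc 0 (dist a b) := by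
    refine ⟨gromovProd_nonneg _ _ _, ?_⟩
    have := dist_triangle x b a
    rw [gromovProd, dist_comm a b]
    linarith [dist_comm x b]
  refine ⟨_, hs, ?_⟩
  set p := g (gromovProd a b x) with hp
  have ha : dist a p = gromovProd a b x := by
    have h := hg 0 ⟨le_rfl, dist_nonneg⟩ _ hs
    rwa [h0, zero_sub, abs_neg, abs_of_nonneg hs.1] at h
  have hb : dist p b = dist a b - gromovProd a b x := by
    have h := hg _ hs _ ⟨dist_nonneg, le_rfl⟩
    rwa [h1, abs_of_nonpos (by linarith [hs.2]), neg_sub] at h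
  have h₁ : (dist x p + gromovProd x a b) / 2 ≤ gromovProd x a p := by
    rw [gromovProd, gromovProd, ha, gromovProd, dist_comm x p, dist_comm b a, dist_comm x a]
    linarith
  have h₂ : (dist x p + gromovProd x a b) / 2 ≤ gromovProd x p b := by
    rw [gromovProd, gromovProd, hb, gromovProd, dist_comm x p, dist_comm b a, dist_comm x a]
    linarith
  linarith [hX.sub_le_gromovProd h₁ h₂]

/-- Rough quasi-isometries of geodesic hyperbolic spaces distort small Gromov products by a bounded
amount. -/
theorem exists_gromovProd_map_le (δ L M c : ℝ) (hδ : 0 ≤ δ) (hL : 1 ≤ L) (hM : 0 ≤ M) :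
    ∃ R : ℝ, ∀ (X : Type*) [MetricSpace X], IsGeodesicSpace X → IsHyperbolic X δ →
      ∀ f : X → X, IsRoughQuasiIsometry f L M → ∀ x a b : X, gromovProd x a b ≤ c →
        gromovProd (f x) (f a) (f b) ≤ R := by
  obtain ⟨R, H⟩ := exists_gromovProd_quasiGeodesic_le δ L M hδ hL hM
  refine ⟨R + (L * (c + 2 * δ) + M), ?_⟩
  intro X _ hgeo hX f hf x a b hc
  obtain ⟨g, h0, h1, hg⟩ := hgeo a b
  have hg : IsGeodesicOn g (dist a b) := hg
  obtain ⟨s, hs, hd⟩ := hg.exists_dist_le hX h0 h1 x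
  have hq : IsQuasiGeodesic (fun t => f (g t)) (dist a b) L M := fun s hs t ht => by
    rw [← hg s hs t ht]
    exact hf.1 _ _
  have h := H X hgeo hX _ _ dist_nonneg hq s hs
  simp only [h0, h1] at h
  have h₂ := gromovProd_le_add_dist (f (g s)) (f x) (f a) (f b)
  have h₃ := (hf.1 x (g s)).2
  have h₄ : L * dist x (g s) ≤ L * (c + 2 * δ) := by gcongr; linarith
  linarith [dist_comm (f x) (f (g s))]

end Morse

/-! ### Coarse centers and boundary values. -/

section Center

variable {X : Type*} [MetricSpace X]

/-- Coarse centers of a triple are coarsely unique. -/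
lemma IsHyperbolic.dist_le_of_centers {δ c : ℝ} (hX : IsHyperbolic X δ) {x y a₁ a₂ a₃ : X}
    (hx₁₂ : gromovProd x a₁ a₂ ≤ c) (hx₁₃ : gromovProd x a₁ a₃ ≤ c) (hx₂₃ : gromovProd x a₂ a₃ ≤ c)
    (hy₁₂ : gromovProd y a₁ a₂ ≤ c) (hy₁₃ : gromovProd y a₁ a₃ ≤ c)
    (hy₂₃ : gromovProd y a₂ a₃ ≤ c) : dist x y ≤ 2 * c + 2 * δ := by
  have key : ∀ {p o a b : X}, gromovProd p a b ≤ c →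
      gromovProd p a o ≤ c + δ ∨ gromovProd p b o ≤ c + δ := by
    intro p o a b h
    have := hX a b o p
    rw [gromovProd_comm p o b] at this
    rcases min_le_iff.1 (show min (gromovProd p a o) (gromovProd p b o) ≤ c + δ by linarith)
      with h | h
    exacts [Or.inl h, Or.inr h]
  have add : ∀ a : X, gromovProd x a y ≤ c + δ → gromovProd y a x ≤ c + δ →
      dist x y ≤ 2 * c + 2 * δ := by
    intro a h₁ h₂
    simp only [gromovProd, dist_comm y x] at h₁ h₂
    linarith
  -- By `key`, at most one `aᵢ` fails the bound at `x` and at most one at `y`, so some `aᵢ`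
  -- satisfies both. The two products in `add` sum to `d(x,y)`.
  rcases key (o := y) hx₁₂ with h₁ | h₁ <;> rcases key (o := y) hx₁₃ with h₂ | h₂ <;>
  rcases key (o := y) hx₂₃ with h₃ | h₃ <;> rcases key (o := x) hy₁₂ with h₄ | h₄ <;>
  rcases key (o := x) hy₁₃ with h₅ | h₅ <;> rcases key (o := x) hy₂₃ with h₆ | h₆ <;>
  first
  | exact add a₁ (by assumption) (by assumption)
  | exact add a₂ (by assumption) (by assumption)
  | exact add a₃ (by assumption) (by assumption)

/-- If `f` is the identity on the boundary, then Gromov products of sequences tending to distinct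
boundary points are bounded in terms of those of their images. -/
lemma eventually_gromovProd_le_of_map {δ : ℝ} (hδ : 0 ≤ δ) (hX : IsHyperbolic X δ) {f : X → X}
    (hf : IsBoundaryExtension f (id : Boundary X → Boundary X)) {ξ ζ : Boundary X} {u v : ℕ → X}
    (hu : Represents u ξ) (hv : Represents v ζ) (y : X) (c : ℝ) :
    ∀ᶠ n in atTop, gromovProd y (f (u n)) (f (v n)) ≤ c →
      gromovProd y (u n) (v n) ≤ c + 2 * δ := by
  filter_upwards [((hf u ξ hu).tendsto_gromovProd hX hu y).eventually_gt_atTop (c + 2 * δ),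
    (hv.tendsto_gromovProd hX (hf v ζ hv) y).eventually_gt_atTop (c + 2 * δ)] with n h₁ h₂ h
  by_contra! h'
  -- The chain `f (u n)`, `u n`, `v n`, `f (v n)` has all its products above `t > c + 2 * δ`.
  obtain ⟨t, ht, ht'⟩ := exists_between (lt_min h₁ (lt_min h' h₂))
  rw [lt_min_iff, lt_min_iff] at ht'
  linarith [hX.sub_two_mul_le_gromovProd hδ ht'.1.le ht'.2.1.le ht'.2.2.le]

end Center

end GromovHyp

end

theorem theorem1p2 (δ K C μ lam ε : ℝ) (hδ : 0 ≤ δ) (hK : 0 ≤ K) (hC : 0 ≤ C) (hμ : 0 ≤ μ)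
    (hlam : 1 ≤ lam) (hε : 0 < ε) (hε1 : ε < 1) (hεδ : ε * (5 * δ) < 1) :
    ∃ Λ : ℝ, ∀ (X : Type*) [MetricSpace X] [ProperSpace X],
      GromovHyp.IsGeodesicSpace X → GromovHyp.IsHyperbolic X δ →
      (∃ ξ : GromovHyp.Boundary X, GromovHyp.IsRoughlyStarlike ξ K) →
      Nontrivial (GromovHyp.Boundary X) →
      (∃ w : X, GromovHyp.IsUniformlyPerfect (GromovHyp.visualDist w ε) C) →
      ∀ f ∈ GromovHyp.teichmullerClass X lam μ, ∀ x : X, dist x (f x) ≤ Λ := by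
  -- The constant is fixed before `1 ≤ C` is available, so the maximum ensures `0 ≤ c`.
  set c := max 0 (6 * δ + 2 + Real.log (2 * C) / ε) with hc
  obtain ⟨R, hR⟩ := GromovHyp.exists_gromovProd_map_le δ lam μ c hδ hlam hμ
  set c' := max c (R + 2 * δ) with hc'
  -- The summands bound `d(x,p)`, `d(p, f p)` and `d(f p, f x)` for `p = γ t`.
  refine ⟨(K + 1) + (2 * c' + 2 * δ) + (lam * (K + 1) + μ), ?_⟩
  rintro X _ _ hgeo hX ⟨ξ, hξ⟩ - ⟨w, hw⟩ f ⟨hf, hfb⟩ x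
  obtain ⟨η, γ, hγ, hdist⟩ := hξ x
  obtain ⟨_, ⟨t, rfl⟩, ht⟩ := (Metric.infDist_lt_iff (Set.range_nonempty γ)).1
    (lt_of_le_of_lt hdist (lt_add_one K))
  obtain ⟨ζ, z, hz, hfreq⟩ := hγ.exists_third_point hδ hε hεδ hX hw t
  obtain ⟨n, ⟨h₁, h₂, h₃⟩, e₁, e₂, e₃⟩ := (hfreq.and_eventually
    ((GromovHyp.eventually_gromovProd_le_of_map hδ hX hfb hγ.2.1 hγ.2.2 (f (γ t)) R).and
    ((GromovHyp.eventually_gromovProd_le_of_map hδ hX hfb hγ.2.1 hz (f (γ t)) R).and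
    (GromovHyp.eventually_gromovProd_le_of_map hδ hX hfb hγ.2.2 hz (f (γ t)) R)))).exists
  replace h₁ := h₁.le.trans (le_max_left 0 _ : 0 ≤ c)
  replace h₂ := h₂.trans (le_max_right 0 _ : _ ≤ c)
  replace h₃ := h₃.trans (le_max_right 0 _ : _ ≤ c)
  have hcc : c ≤ c' := le_max_left _ _
  have hRc : R + 2 * δ ≤ c' := le_max_right _ _
  have hcenter := hX.dist_le_of_centers (h₁.trans hcc) (h₂.trans hcc) (h₃.trans hcc)
    ((e₁ (hR X hgeo hX f hf _ _ _ h₁)).trans hRc) ((e₂ (hR X hgeo hX f hf _ _ _ h₂)).trans hRc)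
    ((e₃ (hR X hgeo hX f hf _ _ _ h₃)).trans hRc)
  have hfx := (hf.1 (γ t) x).2
  rw [dist_comm (γ t) x] at hfx
  have hmul : lam * dist x (γ t) ≤ lam * (K + 1) := by gcongr
  linarith [dist_triangle4 x (γ t) (f (γ t)) (f x)]
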